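/- **Proposition (Injectivity radius growth in congruence covers).** Let $V$ be a closed (compact, connected, without boundary) aspherical smooth Riemannian manifold with fundamental group $\pi=\pi_1(V,x_0)$. Let $L$ be a number field with ring of integers $\mathcal O$, let $S$ be a finite set of places of $L$ containing all Archimedean ones, let $\mathcal O_S$ be the ring of $S$-integers of $L$, let $m\ge 0$, and let $\rho:\pi\hookrightarrow \mathrm{SL}_m(\mathcal O_S)$ be an injective homomorphism. For a nonzero ideal $\mathfrak k\subset\mathcal O$ put $$\mathrm{SL}_m(\mathfrak k)=\ker\big[\mathrm{SL}_m(\mathcal O_S)\to \mathrm{SL}_m(\mathcal O_S/\mathfrak k\mathcal O_S)\big],\qquad \pi(\mathfrak k)=\rho^{-1}(\mathrm{SL}_m(\mathfrak k)),$$ and let $V_{\mathfrak k}\to V$ be the Riemannian covering with fundamental group $\pi(\mathfrak k)$. For a connected Riemannian manifold $W$ with universal Riemannian covering $\widetilde W\to W$, let $\mathrm{InjRad}(W)\in[0,\infty]$ denote the supremum of all $r$ such that $\widetilde W\to W$ is injective on every open ball of radius $r$ in $\widetilde W$ (it is $\infty$ if $W$ is simply connected, and otherwise half of the infimum of the lengths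 of non-contractible loops in $W$). Then there are constants $C>0$ and $D\in\mathbb R$, not depending on $\mathfrak k$, such that for every nonzero ideal $\mathfrak k\subset\mathcal O$ $$\mathrm{InjRad}(V_{\mathfrak k})\ \ge\ C\log k+D ,$$ where $k\ge 1$ is the integer with $(k)=\mathfrak k\mathcal O_S\cap\mathbb Z$. In particular, with the same constants, if $\mathfrak k$ is not divisible by any prime ideal of $\mathcal O$ belonging to $S$, then the same inequality holds for the integer $k\ge1$ with $(k)=\mathfrak k\cap\mathbb Z$. -/

import Mathlib

open Bundle
open scoped Manifold ContDiff ENNReal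

noncomputable section

/-- A space is aspherical if all its homotopy groups `π_k`, `k ≥ 2`, vanish at every base point
(used for connected spaces). -/
def IsAspherical (X : Type*) [TopologicalSpace X] : Prop :=
  ∀ k : ℕ, 2 ≤ k → ∀ x : X, Subsingleton (HomotopyGroup.Pi k X x)

/-- The universal cover of `M` based at `x₀`, as the set of path-homotopy classes (relative to the
end points) of paths that start at `x₀`: a point is an end point together with such a class. -/
def UnivCover (M : Type*) [TopologicalSpace M] (x₀ : M) : Type _ :=
  Σ y : M, Path.Homotopic.Quotient x₀ y

/-- The covering projection of the universal cover: the end point of a class of paths. -/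
def UnivCover.proj {M : Type*} [TopologicalSpace M] {x₀ : M} (a : UnivCover M x₀) : M := a.1

section Riemannian

variable {E : Type*} [NormedAddCommGroup E] [NormedSpace ℝ E]
  {H : Type*} [TopologicalSpace H] (I : ModelWithCorners ℝ E H)
  {M : Type*} [TopologicalSpace M] [ChartedSpace H M]
  [RiemannianBundle (fun x : M ↦ TangentSpace I x)]

/-- The infimum of the Riemannian lengths of the `C^1` paths in a given homotopy class of paths
relative to the end points. (This is `Manifold.riemannianEDist`, with the paths restricted to one
class.) -/
def homotopyClassLength {x y : M} (c : Path.Homotopic.Quotient x y) : ℝ≥0∞ :=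
  ⨅ (γ : Path x y) (_ : Path.Homotopic.Quotient.mk γ = c) (_ : ContMDiff (𝓡∂ 1) I 1 γ),
    ∫⁻ t, ‖mfderiv (𝓡∂ 1) I γ t 1‖ₑ

/-- The distance on the universal cover that comes from the pulled-back Riemannian metric: the
paths in the universal cover from `a` to `b` are exactly the lifts of the paths from `a.proj` to
`b.proj` in the class `a⁻¹ * b`. -/
def UnivCover.edist {x₀ : M} (a b : UnivCover M x₀) : ℝ≥0∞ :=
  homotopyClassLength I (a.2.symm.trans b.2)

variable (M) in
/-- The injectivity radius of a (connected) Riemannian manifold `M`: the supremum of all `r` such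
that the universal covering of `M` is injective on every open ball of radius `r`. It is `∞` if `M`
is simply connected, and it is half of the infimum of the lengths of non-contractible loops
otherwise. -/
def injRad : ℝ≥0∞ :=
  sSup {r : ℝ≥0∞ | ∀ (x₀ : M) (z : UnivCover M x₀),
    Set.InjOn UnivCover.proj {a : UnivCover M x₀ | UnivCover.edist I z a < r}}

/-- A Riemannian covering: a smooth covering map whose differential is isometric at every
point. -/
structure IsRiemannianCovering
    {W : Type*} [TopologicalSpace W] [ChartedSpace H W]
    [RiemannianBundle (fun x : W ↦ TangentSpace I x)] (p : W → M) : Prop where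
  isCoveringMap : IsCoveringMap p
  contMDiff : ContMDiff I I ∞ p
  norm_mfderiv : ∀ (x : W) (v : TangentSpace I x), ‖mfderiv I I p x v‖ = ‖v‖

end Riemannian

section Arithmetic

open IsDedekindDomain NumberField

variable {L : Type*} [Field L] [NumberField L]

/-- The ring `O_S` of `S`-integers of a number field `L`, where `S` lists the non-Archimedean
places (every Archimedean place is always allowed): all `x ∈ L` with `|x|_v ≤ 1` for each
non-Archimedean place `v ∉ S`. -/
abbrev SInt (S : Set (HeightOneSpectrum (𝓞 L))) : Type _ := S.integer L

/-- The extension `𝔨 O_S` of an ideal `𝔨` of the ring of integers to the `S`-integers. -/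
def extIdeal (S : Set (HeightOneSpectrum (𝓞 L))) (𝔨 : Ideal (𝓞 L)) : Ideal (SInt S) :=
  𝔨.map (algebraMap (𝓞 L) (SInt S))

/-- The congruence subgroup `SL_m(𝔨) = ker (SL_m(O_S) → SL_m(O_S / 𝔨 O_S))`. -/
def congruenceSubgroup (m : ℕ) (S : Set (HeightOneSpectrum (𝓞 L))) (𝔨 : Ideal (𝓞 L)) :
    Subgroup (Matrix.SpecialLinearGroup (Fin m) (SInt S)) :=
  (Matrix.SpecialLinearGroup.map (n := Fin m) (Ideal.Quotient.mk (extIdeal S 𝔨))).ker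

end Arithmetic

/-- `p : W → V` is the cover of the pointed space `(V, x₀)` with fundamental group the subgroup
`G ≤ π₁(V, x₀)`: for some `w₀` over `x₀`, the image of `π₁(W, w₀)` under `p` is `G`. -/
def HasCoverGroup {V W : Type*} [TopologicalSpace V] [TopologicalSpace W] (p : C(W, V)) (x₀ : V)
    (G : Subgroup (FundamentalGroup V x₀)) : Prop :=
  ∃ (w₀ : W) (h : p w₀ = x₀), (FundamentalGroup.mapOfEq p h).range = G

end

/-! A comparison of length with word length is played against an arithmetic lower bound for word
length.

Geometry: by compactness there is δ > 0 such that a path in `V` of length less than `N δ` splits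
into `N` short pieces, and each piece, closed up to a loop at `x₀` along chosen paths, gives one of
finitely many elements of π (`exists_basedLoop_mem_pow_of_homotopyClassLength_lt`). If the universal
covering of `V_𝔨` is not injective on some ball of radius `N δ`, two points of the ball with the
same image produce a nontrivial element of π(𝔨) that is a product of `2 N` elements of the finite
set `T ∪ T⁻¹` (`ofReal_le_injRad`).

Arithmetic: let `g ≠ 1` in `SL_m(𝔨)` be a product of `N` matrices from a finite set, and `a` a
nonzero entry of `g - 1`. For a common denominator `d` of the finite set, `d ^ N * a` is a nonzero
algebraic integer in `𝔨 O_S` with all conjugates at most `(2 B) ^ N`. Its norm is a nonzero multiple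
of `k`, so `log k ≤ K N` (`exists_log_le_mul_of_mem_congruenceSubgroup`). -/

/-! ### Closing up path classes to loops at the base point -/

section PathClasses

open Set
open scoped Pointwise

variable {X : Type*} [TopologicalSpace X] {x₀ : X}

/-- The loop at `x₀` that a class of paths from `p` to `q` closes up to, given a choice `τ` of
classes of paths from `x₀` to all points. -/
noncomputable def basedLoop (τ : ∀ p : X, Path.Homotopic.Quotient x₀ p) {p q : X}
    (c : Path.Homotopic.Quotient p q) : FundamentalGroup X x₀ :=
  (τ p).trans (c.trans (τ q).symm)

variable (τ : ∀ p : X, Path.Homotopic.Quotient x₀ p) {p q r : X}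

namespace Path.Homotopic.Quotient

@[simp]
theorem symm_trans_trans (c : Path.Homotopic.Quotient p q) (d : Path.Homotopic.Quotient q r) :
    c.symm.trans (c.trans d) = d := by
  rw [← trans_assoc, symm_trans, refl_trans]

@[simp]
theorem trans_symm_trans (c : Path.Homotopic.Quotient q p) (d : Path.Homotopic.Quotient q r) :
    c.trans (c.symm.trans d) = d := by
  rw [← trans_assoc, trans_symm, refl_trans]

theorem trans_left_injective (c : Path.Homotopic.Quotient p q) :
    Function.Injective fun d : Path.Homotopic.Quotient q r ↦ c.trans d := fun d d' h ↦ by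
  simpa using congrArg (c.symm.trans ·) h

theorem trans_right_injective (c : Path.Homotopic.Quotient q r) :
    Function.Injective fun d : Path.Homotopic.Quotient p q ↦ d.trans c := fun d d' h ↦ by
  simpa using congrArg (trans · c.symm) h

theorem map_trans {Y : Type*} [TopologicalSpace Y] (f : C(X, Y))
    (c : Path.Homotopic.Quotient p q) (d : Path.Homotopic.Quotient q r) :
    (c.trans d).map f = (c.map f).trans (d.map f) := by
  induction c using Path.Homotopic.Quotient.ind with | mk c =>
  induction d using Path.Homotopic.Quotient.ind with | mk d =>
  rw [← mk_trans, ← mk_map, ← mk_map, ← mk_map, ← mk_trans, Path.map_trans]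

theorem map_symm {Y : Type*} [TopologicalSpace Y] (f : C(X, Y))
    (c : Path.Homotopic.Quotient p q) : (c.symm).map f = (c.map f).symm := by
  induction c using Path.Homotopic.Quotient.ind with | mk c => rfl

end Path.Homotopic.Quotient

/-- The return along `τ q` cancels the departure along `τ q`. The order flips because multiplication
in `FundamentalGroup` composes from right to left. -/
theorem basedLoop_trans (c : Path.Homotopic.Quotient p q) (d : Path.Homotopic.Quotient q r) :
    basedLoop τ (c.trans d) = basedLoop τ d * basedLoop τ c := by
  simp [basedLoop, FundamentalGroup.mul_def]

theorem basedLoop_refl : basedLoop τ (.refl p) = 1 := by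
  rw [basedLoop, Path.Homotopic.Quotient.refl_trans, Path.Homotopic.Quotient.trans_symm]
  rfl

theorem basedLoop_symm (c : Path.Homotopic.Quotient p q) :
    basedLoop τ c.symm = (basedLoop τ c)⁻¹ := by
  rw [eq_inv_iff_mul_eq_one, ← basedLoop_trans, Path.Homotopic.Quotient.trans_symm,
    basedLoop_refl]

theorem basedLoop_injective :
    Function.Injective (basedLoop τ : Path.Homotopic.Quotient p q → _) := fun _ _ h ↦
  Path.Homotopic.Quotient.trans_right_injective _
    (Path.Homotopic.Quotient.trans_left_injective _ h)

theorem basedLoop_cast {p' q' : X} (hp : p' = p) (hq : q' = q)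
    (c : Path.Homotopic.Quotient p q) : basedLoop τ (c.cast hp hq) = basedLoop τ c := by
  subst hp hq
  rw [Path.Homotopic.Quotient.cast_rfl_rfl]

/-- `τ x₀` need not be the constant class, so closing up a loop at `x₀` conjugates it; normality of
the covering group absorbs this later. -/
theorem basedLoop_self (c : FundamentalGroup X x₀) :
    basedLoop τ (p := x₀) (q := x₀) c =
      (show FundamentalGroup X x₀ from τ x₀)⁻¹ * c * (show FundamentalGroup X x₀ from τ x₀) := by
  simp only [FundamentalGroup.mul_def, FundamentalGroup.inv_def, basedLoop]

/-- If the pieces of a path between the times `t i` all give loops in `T`, then the first `k` pieces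
together give a product of `k` elements of `T`. -/
theorem basedLoop_subpath_mem_pow {T : Set (FundamentalGroup X x₀)} (γ : Path p q)
    (t : ℕ → unitInterval) (k : ℕ)
    (h : ∀ i < k, basedLoop τ (.mk (γ.subpath (t i) (t (i + 1)))) ∈ T) :
    basedLoop τ (.mk (γ.subpath (t 0) (t k))) ∈ T ^ k := by
  induction k with
  | zero =>
    rw [Path.subpath_self, Path.Homotopic.Quotient.mk_refl, basedLoop_refl, pow_zero]
    exact Set.one_mem_one
  | succ k ih =>
    have := Path.Homotopic.Quotient.eq.2
      ⟨Path.Homotopy.subpathTransSubpath γ (t 0) (t k) (t (k + 1))⟩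
    rw [← this, Path.Homotopic.Quotient.mk_trans, basedLoop_trans, pow_succ']
    exact Set.mul_mem_mul (h k k.lt_succ_self) (ih fun i hi ↦ h i (hi.trans k.lt_succ_self))

theorem basedLoop_mem_pow {T : Set (FundamentalGroup X x₀)} (γ : Path p q)
    (t : ℕ → unitInterval) (k : ℕ) (h0 : t 0 = 0) (hk : t k = 1)
    (h : ∀ i < k, basedLoop τ (.mk (γ.subpath (t i) (t (i + 1)))) ∈ T) :
    basedLoop τ (.mk γ) ∈ T ^ k := by
  have := basedLoop_subpath_mem_pow τ γ t k h
  rwa [h0, hk, Path.subpath_zero_one, Path.Homotopic.Quotient.mk_cast, basedLoop_cast] at this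

end PathClasses

/-! ### Short paths give finitely many loops -/

section ShortPaths

open Set Topology

variable {X : Type*}

/-- Two paths with the same end points in a simply connected subset are homotopic. -/
theorem Path.homotopic_of_range_subset [TopologicalSpace X] {S : Set X} [SimplyConnectedSpace S]
    {p q : X} {γ γ' : Path p q} (h : range γ ⊆ S) (h' : range γ' ⊆ S) : γ.Homotopic γ' := by
  have hp : p ∈ S := h ⟨0, γ.source⟩
  have hq : q ∈ S := h ⟨1, γ.target⟩
  let δ : Path (⟨p, hp⟩ : S) ⟨q, hq⟩ :=
    { toFun := fun t ↦ ⟨γ t, h ⟨t, rfl⟩⟩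
      source' := by simp
      target' := by simp }
  let δ' : Path (⟨p, hp⟩ : S) ⟨q, hq⟩ :=
    { toFun := fun t ↦ ⟨γ' t, h' ⟨t, rfl⟩⟩
      source' := by simp
      target' := by simp }
  exact (SimplyConnectedSpace.paths_homotopic δ δ').map ⟨Subtype.val, continuous_subtype_val⟩

theorem ChartedSpace.exists_mem_nhds_contractibleSpace {E : Type*} [NormedAddCommGroup E]
    [NormedSpace ℝ E] [TopologicalSpace X] [ChartedSpace E X] (x : X) :
    ∃ U ∈ 𝓝 x, ContractibleSpace U := by
  let e := chartAt E x
  obtain ⟨r, hr, hrt⟩ := Metric.mem_nhds_iff.1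
    (e.open_target.mem_nhds (e.map_source (mem_chart_source E x)))
  refine ⟨e.symm '' Metric.ball (e x) r, ?_, ?_⟩
  · nth_rewrite 1 [← e.left_inv (mem_chart_source E x)]
    exact e.symm.image_mem_nhds (e.map_source (mem_chart_source E x)) (Metric.ball_mem_nhds _ hr)
  · have := (convex_ball (e x) r).contractibleSpace ⟨e x, Metric.mem_ball_self hr⟩
    exact (e.symm.homeomorphOfImageSubsetSource hrt rfl).symm.contractibleSpace

/-- In a compact, connected and locally contractible space, all paths of diameter less than some
`δ` give only finitely many loops, after closing them up in a suitable way. -/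
theorem exists_finite_basedLoop_mem [PseudoEMetricSpace X] [CompactSpace X]
    [PathConnectedSpace X] [LocallyPathConnectedSpace X]
    (hX : ∀ x : X, ∃ U ∈ 𝓝 x, ContractibleSpace U) (x₀ : X) :
    ∃ (τ : ∀ p : X, Path.Homotopic.Quotient x₀ p) (T : Set (FundamentalGroup X x₀)),
      T.Finite ∧ ∃ δ > (0 : ℝ≥0∞), ∀ {p q : X} (γ : Path p q),
        range γ ⊆ Metric.eball p δ → basedLoop τ (.mk γ) ∈ T := by
  choose U hU hUc using hX
  -- Lebesgue number: every ball of radius `ε` lies in a contractible set, so paths inside it are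
  -- determined up to homotopy by their end points.
  obtain ⟨ε, hε, hball⟩ := lebesgue_number_lemma_of_emetric_nhds isCompact_univ
    fun x _ ↦ hU x
  have hhom : ∀ {x p q : X} (γ γ' : Path p q), range γ ⊆ Metric.eball x ε →
      range γ' ⊆ Metric.eball x ε → γ.Homotopic γ' := fun {x p q} γ γ' h h' ↦ by
    obtain ⟨y, hy⟩ := hball x (mem_univ x)
    exact Path.homotopic_of_range_subset (h.trans hy) (h'.trans hy)
  -- The path from `c p` to `p`, along `γ` to `q` and back to `c q` stays within four steps of size
  -- `δ` of `c p`.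
  set δ := ε / 4 with hδ
  have hδ0 : 0 < δ := ENNReal.div_pos hε.ne' (by simp)
  have hδ4 : δ + δ + δ + δ = ε := by
    rw [hδ, ← ENNReal.add_div, ← ENNReal.add_div, ← ENNReal.add_div]
    rw [show ε + ε + ε + ε = ε * 4 by ring]
    exact ENNReal.mul_div_cancel_right (by simp) (by simp)
  have hpc (x : X) : ∃ W, (W ∈ 𝓝 x ∧ IsPathConnected W) ∧ W ⊆ Metric.eball x δ :=
    (path_connected_basis x).mem_iff.1 (Metric.eball_mem_nhds x hδ0)
  choose W hW hWδ using hpc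
  obtain ⟨s, hs⟩ := CompactSpace.elim_nhds_subcover W fun x ↦ (hW x).1
  have hcov (p : X) : ∃ x ∈ s, p ∈ W x := by simpa using hs.ge (mem_univ p)
  choose c hcs hcW using hcov
  have hσ (p : X) : ∃ σ : Path (c p) p, range σ ⊆ Metric.eball (c p) δ := by
    obtain ⟨σ, hσ⟩ := (hW (c p)).2.joinedIn _ (mem_of_mem_nhds (hW (c p)).1) _ (hcW p)
    exact ⟨σ, (range_subset_iff.2 hσ).trans (hWδ _)⟩
  choose σ hσ using hσ
  let α (x : X) : Path.Homotopic.Quotient x₀ x := .mk (PathConnectedSpace.somePath x₀ x)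
  -- `τ p` runs through a point `c p` of a finite net. Each pair of net points contributes at most
  -- one loop, since all its connecting paths in the `ε`-ball are homotopic.
  refine ⟨fun p ↦ (α (c p)).trans (.mk (σ p)),
    ⋃ x ∈ s, ⋃ y ∈ s, {g | ∃ γ : Path x y, range γ ⊆ Metric.eball x ε ∧
      g = (α x).trans (.trans (.mk γ) (α y).symm)}, ?_, δ, hδ0, ?_⟩
  · refine s.finite_toSet.biUnion fun x _ ↦ s.finite_toSet.biUnion fun y _ ↦ ?_
    refine Set.Subsingleton.finite ?_
    rintro _ ⟨γ, hγ, rfl⟩ _ ⟨γ', hγ', rfl⟩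
    rw [Path.Homotopic.Quotient.eq.2 (hhom γ γ' hγ hγ')]
  · intro p q γ hγ
    simp only [mem_iUnion]
    refine ⟨c p, hcs p, c q, hcs q, (σ p).trans (γ.trans (σ q).symm), ?_, ?_⟩
    · have hp : edist (c p) p < δ := by
        simpa [edist_comm] using hσ p ⟨1, (σ p).target⟩
      have hq : edist (c q) q < δ := by
        simpa [edist_comm] using hσ q ⟨1, (σ q).target⟩
      have hpq : edist p q < δ := by
        simpa [edist_comm] using hγ ⟨1, γ.target⟩
      rw [Path.trans_range, Path.trans_range, Path.symm_range, ← hδ4]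
      refine union_subset ?_ (union_subset ?_ ?_)
      · exact (hσ p).trans (Metric.eball_subset_eball (by
          rw [add_assoc, add_assoc]; exact le_self_add))
      · intro z hz
        have hz : edist z p < δ := hγ hz
        rw [edist_comm] at hz
        rw [Metric.mem_eball, edist_comm]
        calc edist (c p) z ≤ edist (c p) p + edist p z := edist_triangle _ _ _
          _ < δ + δ := ENNReal.add_lt_add hp hz
          _ ≤ δ + δ + δ + δ := by rw [add_assoc]; exact le_self_add
      · intro z hz
        have hz : edist z (c q) < δ := hσ q hz
        rw [edist_comm] at hz hq
        rw [Metric.mem_eball, edist_comm]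
        calc edist (c p) z ≤ edist (c p) p + edist p q + edist q (c q) + edist (c q) z :=
            (edist_triangle _ (c q) _).trans (by gcongr; exact edist_triangle4 _ _ _ _)
          _ < δ + δ + δ + δ := ENNReal.add_lt_add (ENNReal.add_lt_add
            (ENNReal.add_lt_add hp hpq) hq) hz
    · have hsymm : ((α (c q)).trans (.mk (σ q))).symm = (Path.Homotopic.Quotient.mk (σ q)).symm.trans
          (α (c q)).symm := by
        apply Path.Homotopic.Quotient.trans_left_injective ((α (c q)).trans (.mk (σ q)))
        simp
      simp [basedLoop, hsymm, Path.Homotopic.Quotient.mk_trans, Path.Homotopic.Quotient.mk_symm]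

end ShortPaths

/-! ### Arc length and subdivision of paths -/

section Length

open Set Manifold MeasureTheory

variable {E : Type*} [NormedAddCommGroup E] [NormedSpace ℝ E]
  {H : Type*} [TopologicalSpace H] {I : ModelWithCorners ℝ E H}
  {M : Type*} [TopologicalSpace M] [ChartedSpace H M]
  [RiemannianBundle (fun x : M ↦ TangentSpace I x)]

/-- A path of finite length on `[0, 1]` has a continuous monotone arc length function. -/
theorem exists_continuous_arcLength {γ : ℝ → M} (hfin : pathELength I γ 0 1 ≠ ⊤) :
    ∃ ℓ : ℝ → ℝ, Continuous ℓ ∧ Monotone ℓ ∧ ℓ 0 = 0 ∧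
      ENNReal.ofReal (ℓ 1) = pathELength I γ 0 1 ∧
      ∀ s t, 0 ≤ s → s ≤ t → t ≤ 1 → pathELength I γ s t = ENNReal.ofReal (ℓ t - ℓ s) := by
  -- The arc length is the primitive of the measure whose density is the speed; it is continuous
  -- because this measure has no atoms.
  let ν : Measure ℝ := (volume.restrict (Icc 0 1)).withDensity fun t ↦ ‖mfderiv% γ t 1‖ₑ
  have : IsFiniteMeasure ν := ⟨by
    rw [withDensity_apply _ MeasurableSet.univ, Measure.restrict_univ,
      ← pathELength_eq_lintegral_mfderiv_Icc]
    exact hfin.lt_top⟩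
  have hν (s t : ℝ) (hs : 0 ≤ s) (ht : t ≤ 1) : ν (Ioc s t) = pathELength I γ s t := by
    rw [withDensity_apply _ measurableSet_Ioc, Measure.restrict_restrict measurableSet_Ioc,
      inter_eq_left.2 (Ioc_subset_Icc_self.trans (Icc_subset_Icc hs ht)),
      pathELength_eq_lintegral_mfderiv_Icc, restrict_Ioc_eq_restrict_Icc]
  have hint (a b : ℝ) : IntervalIntegrable (fun _ ↦ (1 : ℝ)) ν a b := intervalIntegrable_const
  have hsub (s t : ℝ) (hst : s ≤ t) :
      (∫ _ in (0 : ℝ)..t, (1 : ℝ) ∂ν) - (∫ _ in (0 : ℝ)..s, (1 : ℝ) ∂ν) = ν.real (Ioc s t) := by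
    rw [intervalIntegral.integral_interval_sub_left (hint _ _) (hint _ _),
      intervalIntegral.integral_of_le hst]
    simp
  have key (s t : ℝ) (hs : 0 ≤ s) (hst : s ≤ t) (ht : t ≤ 1) : pathELength I γ s t =
      ENNReal.ofReal ((∫ _ in (0 : ℝ)..t, (1 : ℝ) ∂ν) - (∫ _ in (0 : ℝ)..s, (1 : ℝ) ∂ν)) := by
    rw [hsub s t hst, ← hν s t hs ht, ofReal_measureReal]
  refine ⟨fun t ↦ ∫ _ in (0 : ℝ)..t, (1 : ℝ) ∂ν, intervalIntegral.continuous_primitive hint 0,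
    fun s t hst ↦ ?_, by simp, ?_, key⟩
  · rw [← sub_nonneg, hsub s t hst]
    exact measureReal_nonneg
  · rw [key 0 1 le_rfl zero_le_one le_rfl]
    simp

/-- A `C^1` path of length less than `N δ` can be cut into `N` pieces that stay within distance
less than `δ` of their starting points. -/
theorem exists_subdivision [IsManifold I 1 M] {p q : M} {γ : Path p q}
    (hγ : ContMDiff (𝓡∂ 1) I 1 γ) {N : ℕ} {δ : ℝ} (hδ : 0 < δ)
    (hlt : ∫⁻ t, ‖mfderiv (𝓡∂ 1) I γ t 1‖ₑ < ENNReal.ofReal (N * δ)) :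
    ∃ t : ℕ → unitInterval, t 0 = 0 ∧ t N = 1 ∧ ∀ i < N, ∀ x ∈ range (γ.subpath (t i) (t (i + 1))),
      riemannianEDist I (γ (t i)) x < ENNReal.ofReal δ := by
  have hN : 0 < N := by
    rcases N.eq_zero_or_pos with rfl | h
    · simp at hlt
    · exact h
  have hN' : (0 : ℝ) < N := by exact_mod_cast hN
  rw [lintegral_norm_mfderiv_Icc_eq_pathELength_projIcc] at hlt
  have hC : ContMDiffOn 𝓘(ℝ, ℝ) I 1 (γ ∘ projIcc 0 1 zero_le_one) (Icc 0 1) :=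
    contMDiffOn_comp_projIcc_iff.2 hγ
  obtain ⟨ℓ, hcont, hmono, h0, h1, hℓ⟩ := exists_continuous_arcLength
    (hlt.trans ENNReal.ofReal_lt_top).ne
  have hℓ1 : 0 ≤ ℓ 1 := h0 ▸ hmono zero_le_one
  have hℓN : ℓ 1 / N < δ := by
    rw [← h1, ENNReal.ofReal_lt_ofReal_iff (by positivity)] at hlt
    rwa [div_lt_iff₀ hN', mul_comm]
  have hdist (s t : unitInterval) : riemannianEDist I (γ s) (γ t) ≤
      ENNReal.ofReal |ℓ t - ℓ s| := by
    have aux (s t : unitInterval) (hst : s ≤ t) : riemannianEDist I (γ s) (γ t) ≤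
        ENNReal.ofReal (ℓ t - ℓ s) := by
      rw [← hℓ s t s.2.1 hst t.2.2]
      exact riemannianEDist_le_pathELength (hC.mono (Icc_subset_Icc s.2.1 t.2.2)) (by simp)
        (by simp) hst
    rcases le_total s t with h | h
    · exact (aux s t h).trans (ENNReal.ofReal_le_ofReal (le_abs_self _))
    · rw [riemannianEDist_comm, abs_sub_comm]
      exact (aux t s h).trans (ENNReal.ofReal_le_ofReal (le_abs_self _))
  have hex (i : ℕ) (hi : i ≤ N) : ∃ t : unitInterval, ℓ t = i * (ℓ 1 / N) := by
    have : i * (ℓ 1 / N) ∈ Icc (ℓ 0) (ℓ 1) := by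
      rw [h0]
      refine ⟨by positivity, ?_⟩
      calc i * (ℓ 1 / N) ≤ N * (ℓ 1 / N) := by gcongr
        _ = ℓ 1 := by field_simp
    obtain ⟨t, ht, h⟩ := intermediate_value_Icc zero_le_one hcont.continuousOn this
    exact ⟨⟨t, ht⟩, h⟩
  choose! u hu using hex
  -- The end points are set by hand: `ℓ` may be constant near 0 or 1, so `u 0` and `u N` could be
  -- interior times.
  let t (i : ℕ) : unitInterval := if i = 0 then 0 else if i = N then 1 else u i
  have ht (i : ℕ) (hi : i ≤ N) : ℓ (t i) = i * (ℓ 1 / N) := by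
    by_cases hi0 : i = 0
    · simp [t, hi0, h0]
    by_cases hiN : i = N
    · simp only [t, hiN, hN.ne', if_false, if_true, Icc.coe_one]
      field_simp
    · simp only [t, hi0, hiN, if_false, hu i hi]
  refine ⟨t, by simp [t], by simp [t, hN.ne'], fun i hi x hx ↦ ?_⟩
  rw [Path.range_subpath] at hx
  obtain ⟨s, hs, rfl⟩ := hx
  refine (hdist _ _).trans_lt ((ENNReal.ofReal_lt_ofReal_iff hδ).2 (lt_of_le_of_lt ?_ hℓN))
  have hstep : ℓ (t (i + 1)) - ℓ (t i) = ℓ 1 / N := by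
    rw [ht _ hi, ht _ hi.le]; push_cast; ring
  -- Unordered intervals are needed because the times `t i` may fail to increase when the total
  -- length is 0.
  have hs' : ℓ s ∈ uIcc (ℓ (t i)) (ℓ (t (i + 1))) := by
    have hm : Monotone fun x : unitInterval ↦ ℓ x := fun _ _ h ↦ hmono h
    exact hm.mapsTo_uIcc hs
  calc |ℓ s - ℓ (t i)| ≤ |ℓ (t (i + 1)) - ℓ (t i)| := abs_sub_left_of_mem_uIcc hs'
    _ = ℓ 1 / N := by rw [hstep, abs_of_nonneg (by positivity)]

theorem lintegral_enorm_mfderiv_comp {W : Type*} [TopologicalSpace W] [ChartedSpace H W]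
    [RiemannianBundle (fun x : W ↦ TangentSpace I x)] {f : W → M}
    (hf : IsRiemannianCovering I f) {γ : unitInterval → W} (hγ : ContMDiff (𝓡∂ 1) I 1 γ) :
    ∫⁻ t, ‖mfderiv (𝓡∂ 1) I (f ∘ γ) t 1‖ₑ = ∫⁻ t, ‖mfderiv (𝓡∂ 1) I γ t 1‖ₑ := by
  refine lintegral_congr fun t ↦ ?_
  rw [mfderiv_comp t ((hf.contMDiff.mdifferentiable (by simp)) _)
    ((hγ.mdifferentiable one_ne_zero) t)]
  have := hf.norm_mfderiv (γ t) (mfderiv (𝓡∂ 1) I γ t 1)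
  rw [← ofReal_norm, ← ofReal_norm, ← this]
  rfl

end Length

/-! ### Word length in congruence subgroups -/

section Arithmetic

open IsDedekindDomain NumberField
open scoped Pointwise

variable {L : Type*} [Field L] [NumberField L] {S : Set (HeightOneSpectrum (𝓞 L))}

/-- A nonzero integer of a number field that lies in `𝔨 O_S` bounds the generator of
`𝔨 O_S ∩ ℤ` through its norm. -/
theorem natCast_le_pow_of_mem_extIdeal {𝔨 : Ideal (𝓞 L)} {k : ℕ}
    (hk : (extIdeal S 𝔨).comap (algebraMap ℤ (SInt S)) = Ideal.span {(k : ℤ)})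
    {b : 𝓞 L} (hb : b ≠ 0) (hmem : algebraMap (𝓞 L) (SInt S) b ∈ extIdeal S 𝔨)
    {R : ℝ} (hR : ∀ σ : L →+* ℂ, ‖σ b‖ ≤ R) :
    (k : ℝ) ≤ R ^ Module.finrank ℚ L := by
  set N := Ideal.absNorm (Ideal.span {b}) with hN
  have hN0 : 0 < N := by
    rw [hN, Ideal.absNorm_span_singleton, Int.natAbs_pos]
    exact Algebra.norm_ne_zero_iff.2 hb
  -- The absolute norm of `b` is a multiple of `b` in `𝓞 L`, hence an integer in `𝔨 O_S ∩ ℤ = (k)`.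
  have hdvd : k ∣ N := by
    obtain ⟨c, hc⟩ := Ideal.mem_span_singleton.1 (Ideal.absNorm_mem (Ideal.span {b}))
    rw [← Int.natCast_dvd_natCast, ← Ideal.mem_span_singleton, ← hk, Ideal.mem_comap]
    have : algebraMap ℤ (SInt S) (N : ℤ) = algebraMap (𝓞 L) (SInt S) c *
        algebraMap (𝓞 L) (SInt S) b := by
      rw [← map_mul, mul_comm, ← hc]
      simp [hN]
    rw [this]
    exact Ideal.mul_mem_left _ _ hmem
  calc (k : ℝ) ≤ N := by exact_mod_cast Nat.le_of_dvd hN0 hdvd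
    _ = ‖algebraMap ℚ ℂ (Algebra.norm ℚ (b : L))‖ := by
      rw [hN, Ideal.absNorm_span_singleton, ← Algebra.coe_norm_int]
      simp [Nat.cast_natAbs]
    _ = ∏ σ : L →ₐ[ℚ] ℂ, ‖σ b‖ := by
      rw [Algebra.norm_eq_prod_embeddings, norm_prod]
    _ ≤ ∏ _σ : L →ₐ[ℚ] ℂ, R := Finset.prod_le_prod (fun _ _ ↦ norm_nonneg _)
      fun σ _ ↦ hR (σ : L →+* ℂ)
    _ = R ^ Module.finrank ℚ L := by
      rw [Finset.prod_const, Finset.card_univ, AlgHom.card]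

/-- Products of `N` matrices from a finite set have entries whose denominators and whose
Archimedean absolute values grow at most exponentially in `N`. -/
theorem exists_isIntegral_and_norm_le_pow {m : ℕ}
    {T : Set (Matrix.SpecialLinearGroup (Fin m) (SInt S))} (hT : T.Finite) :
    ∃ (d : ℕ) (B : ℝ), 0 < d ∧ d ≤ B ∧ ∀ (N : ℕ), ∀ g ∈ T ^ N, ∀ i j,
      IsIntegral ℤ ((d : L) ^ N * (g i j : SInt S)) ∧
      ∀ σ : L →+* ℂ, ‖σ ((d : L) ^ N * (g i j : SInt S))‖ ≤ B ^ N := by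
  classical
  let A : Set L := ⋃ t ∈ T, ⋃ i, ⋃ j, {((t i j : SInt S) : L)}
  have hA : A.Finite := hT.biUnion fun t _ ↦ Set.finite_iUnion fun i ↦
    Set.finite_iUnion fun j ↦ Set.finite_singleton _
  have hmemA {t} (ht : t ∈ T) (i j : Fin m) : ((t i j : SInt S) : L) ∈ A := by
    simp only [A, Set.mem_iUnion]
    exact ⟨t, ht, i, j, rfl⟩
  obtain ⟨y, hy, hint⟩ := exists_integral_multiples ℤ ℚ hA.toFinset
  set d := y.natAbs with hd
  have hd0 : 0 < d := Int.natAbs_pos.2 hy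
  have hdint {a} (ha : a ∈ A) : IsIntegral ℤ ((d : L) * a) := by
    have := hint a (hA.mem_toFinset.2 ha)
    rw [zsmul_eq_mul] at this
    rcases Int.natAbs_eq y with h | h <;> rw [h, ← hd] at this
    · simpa only [Int.cast_natCast] using this
    · simpa only [Int.cast_neg, Int.cast_natCast, neg_mul, neg_neg] using this.neg
  obtain ⟨B₀, hB₀⟩ : ∃ B₀ : ℝ, ∀ a ∈ A, ∀ σ : L →+* ℂ, ‖σ (d * a)‖ ≤ B₀ := by
    obtain ⟨B₀, h⟩ := ((hA.prod (Set.finite_univ (α := L →+* ℂ))).image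
      fun x ↦ ‖x.2 (d * x.1)‖).bddAbove
    exact ⟨B₀, fun a ha σ ↦ h ⟨(a, σ), ⟨ha, trivial⟩, rfl⟩⟩
  -- An entry of a product is a sum of `m` terms, which costs `m * B₀` per factor. Taking `d ≤ B`
  -- also bounds the entries of `d ^ N` times the identity matrix, for later use.
  set B : ℝ := max d (m * B₀) with hB
  have hB0 : 0 < B := (Nat.cast_pos.2 hd0).trans_le (le_max_left _ _)
  refine ⟨d, B, hd0, le_max_left _ _, fun N ↦ ?_⟩
  induction N with
  | zero =>
    intro g hg i j
    rw [pow_zero, Set.mem_one] at hg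
    subst hg
    rcases eq_or_ne i j with rfl | hij
    · simp [isIntegral_one]
    · simp [hij, isIntegral_zero]
  | succ N ih =>
    intro g hg i j
    rw [pow_succ] at hg
    obtain ⟨h, hh, t, ht, rfl⟩ := Set.mem_mul.1 hg
    have hexp : (d : L) ^ (N + 1) * (((h * t) i j : SInt S) : L) =
        ∑ l, ((d : L) ^ N * (h i l : SInt S)) * (d * (t l j : SInt S)) := by
      rw [Matrix.SpecialLinearGroup.coe_mul, Matrix.mul_apply]
      push_cast
      rw [Finset.mul_sum]
      exact Finset.sum_congr rfl fun l _ ↦ by ring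
    rw [hexp]
    refine ⟨IsIntegral.sum _ fun l _ ↦ (ih h hh i l).1.mul (hdint (hmemA ht l j)), fun σ ↦ ?_⟩
    rw [map_sum]
    calc ‖∑ l, σ (((d : L) ^ N * (h i l : SInt S)) * (d * (t l j : SInt S)))‖
        ≤ ∑ _l : Fin m, B ^ N * B₀ := by
          refine norm_sum_le_of_le _ fun l _ ↦ ?_
          rw [map_mul, norm_mul]
          exact mul_le_mul ((ih h hh i l).2 σ) (hB₀ _ (hmemA ht l j) σ) (norm_nonneg _)
            (by positivity)
      _ = B ^ N * (m * B₀) := by simp; ring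
      _ ≤ B ^ (N + 1) := by
        rw [pow_succ]
        exact mul_le_mul_of_nonneg_left (le_max_right _ _) (by positivity)

/-- A nontrivial element of a congruence subgroup of level `k` has word length at least
proportional to `log k`. -/
theorem exists_log_le_mul_of_mem_congruenceSubgroup {m : ℕ}
    {T : Set (Matrix.SpecialLinearGroup (Fin m) (SInt S))} (hT : T.Finite) :
    ∃ K : ℝ, 0 < K ∧ ∀ (N : ℕ), ∀ g ∈ T ^ N, g ≠ 1 → ∀ 𝔨 : Ideal (𝓞 L),
      g ∈ congruenceSubgroup m S 𝔨 → ∀ k : ℕ,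
      (extIdeal S 𝔨).comap (algebraMap ℤ (SInt S)) = Ideal.span {(k : ℤ)} →
      Real.log k ≤ K * N := by
  obtain ⟨d, B, hd, hdB, hT⟩ := exists_isIntegral_and_norm_le_pow (L := L) hT
  have hB : 1 ≤ B := le_trans (by exact_mod_cast hd) hdB
  have hlog : 0 < Real.log (2 * B) := Real.log_pos (by linarith)
  have hfin : 0 < (Module.finrank ℚ L : ℝ) := by exact_mod_cast Module.finrank_pos
  refine ⟨Module.finrank ℚ L * Real.log (2 * B), by positivity, ?_⟩
  intro N g hg hg1 𝔨 hmem k hk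
  have hN : N ≠ 0 := by
    rintro rfl
    exact hg1 (by simpa using hg)
  obtain ⟨i, j, hij⟩ : ∃ i j, g i j ≠ (1 : Matrix (Fin m) (Fin m) (SInt S)) i j := by
    by_contra! h
    exact hg1 (Subtype.ext (Matrix.ext h))
  set a : SInt S := g i j - (1 : Matrix (Fin m) (Fin m) (SInt S)) i j with ha
  have hone : ((1 : Matrix (Fin m) (Fin m) (SInt S)) i j : SInt S) =
      if i = j then (1 : SInt S) else 0 := Matrix.one_apply
  have ha_mem : a ∈ extIdeal S 𝔨 := by
    rw [congruenceSubgroup, MonoidHom.mem_ker] at hmem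
    have h := congrFun (congrFun (congrArg Subtype.val hmem) i) j
    rw [← Ideal.Quotient.eq_zero_iff_mem, ha, map_sub, sub_eq_zero]
    refine h.trans ?_
    rw [hone, Matrix.SpecialLinearGroup.coe_one, Matrix.one_apply]
    split_ifs <;> simp
  have hint : IsIntegral ℤ ((d : L) ^ N * (a : L)) := by
    rw [ha, AddSubgroupClass.coe_sub, mul_sub, hone]
    refine (hT N g hg i j).1.sub ?_
    split_ifs
    · simpa using (IsIntegral.pow (isIntegral_algebraMap (R := ℤ) (A := L) (x := (d : ℤ))) N)
    · simp [isIntegral_zero]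
  let b : 𝓞 L := ⟨(d : L) ^ N * (a : L), hint⟩
  have hbL : (b : L) = (d : L) ^ N * (a : L) := rfl
  have hb : algebraMap (𝓞 L) (SInt S) b = (d : SInt S) ^ N * a := by
    apply Subtype.ext
    push_cast
    exact hbL
  have hb0 : b ≠ 0 := by
    have ha0 : a ≠ 0 := sub_ne_zero.2 hij
    refine RingOfIntegers.coe_ne_zero_iff.1 (ne_of_eq_of_ne hbL ?_)
    exact mul_ne_zero (pow_ne_zero _ (Nat.cast_ne_zero.2 hd.ne')) fun h ↦ ha0 (Subtype.ext h)
  have hbound (σ : L →+* ℂ) : ‖σ b‖ ≤ (2 * B) ^ N := by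
    have h1 : ‖σ ((d : L) ^ N * ((if i = j then (1 : SInt S) else 0 : SInt S) : L))‖ ≤ B ^ N := by
      split_ifs
      · simpa using pow_le_pow_left₀ (Nat.cast_nonneg d) hdB N
      · simp; positivity
    calc ‖σ b‖ ≤ B ^ N + B ^ N := by
          rw [hbL, ha, AddSubgroupClass.coe_sub, mul_sub, hone, map_sub]
          exact (norm_sub_le _ _).trans (add_le_add ((hT N g hg i j).2 σ) h1)
      _ = 2 * B ^ N := by ring
      -- This uses `N ≠ 0`, which holds since the empty product is 1.
      _ ≤ 2 ^ N * B ^ N := by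
        gcongr
        exact le_self_pow₀ one_le_two hN
      _ = (2 * B) ^ N := (mul_pow _ _ _).symm
  have hle := natCast_le_pow_of_mem_extIdeal hk hb0 (hb ▸ Ideal.mul_mem_left _ _ ha_mem) hbound
  -- For `k = 0` the claim holds by the convention `Real.log 0 = 0`.
  rcases k.eq_zero_or_pos with rfl | hk0
  · simp; positivity
  · refine (Real.log_le_log (by exact_mod_cast hk0) hle).trans_eq ?_
    rw [Real.log_pow, Real.log_pow]
    ring

/-- If no prime ideal in `S` divides `𝔨`, then `𝔨 O_S ∩ O = 𝔨`. -/
theorem comap_extIdeal {𝔨 : Ideal (𝓞 L)} (h0 : 𝔨 ≠ ⊥) (hS : ∀ 𝔮 ∈ S, ¬ 𝔮.asIdeal ∣ 𝔨) :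
    (extIdeal S 𝔨).comap (algebraMap (𝓞 L) (SInt S)) = 𝔨 := by
  have hinj : Function.Injective (algebraMap (𝓞 L) (SInt S)) := fun x y h ↦
    RingOfIntegers.ext (congrArg (Subtype.val : SInt S → L) h)
  -- Every `S`-integer has a denominator congruent to 1 modulo `𝔨`: its ideal `J` of denominators is
  -- coprime to `𝔨`, because a maximal ideal containing `𝔨` is not in `S`, so `s` is integral there
  -- and has a denominator outside it.
  have hden (s : SInt S) : ∃ t r : 𝓞 L, t - 1 ∈ 𝔨 ∧
      algebraMap (𝓞 L) (SInt S) t * s = algebraMap (𝓞 L) (SInt S) r := by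
    let J : Ideal (𝓞 L) :=
      (Submodule.span (𝓞 L) {(1 : SInt S)}).comap (LinearMap.toSpanSingleton (𝓞 L) (SInt S) s)
    have hJ {t : 𝓞 L} : t ∈ J ↔ ∃ r, algebraMap (𝓞 L) (SInt S) t * s =
        algebraMap (𝓞 L) (SInt S) r := by
      simp only [J, Submodule.mem_comap, Submodule.mem_span_singleton,
        LinearMap.toSpanSingleton_apply, Algebra.smul_def, mul_one]
      exact exists_congr fun _ ↦ eq_comm
    have hsup : J ⊔ 𝔨 = ⊤ := by
      by_contra hne
      obtain ⟨M, hM, hle⟩ := Ideal.exists_le_maximal _ hne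
      have hk : 𝔨 ≤ M := le_sup_right.trans hle
      let 𝔮 : HeightOneSpectrum (𝓞 L) := ⟨M, hM.isPrime, ne_bot_of_le_ne_bot h0 hk⟩
      have hq : 𝔮 ∉ S := fun h ↦ hS 𝔮 h (Ideal.dvd_iff_le.2 hk)
      have hval : 𝔮.valuation L (s : L) ≤ 1 := s.2 𝔮 hq
      obtain ⟨r, t, ht, hrt⟩ : ∃ r t : 𝓞 L, t ∉ M ∧ (t : L) * (s : L) = r := by
        obtain ⟨r, t, h⟩ := 𝔮.exists_primeCompl_mul_eq_of_integer (s : L) hval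
        exact ⟨r, t, t.2, (mul_comm _ _).trans h⟩
      exact ht (hle (Ideal.mem_sup_left (hJ.2 ⟨r, Subtype.ext hrt⟩)))
    obtain ⟨t, ht, u, hu, htu⟩ := Submodule.mem_sup.1 ((Ideal.eq_top_iff_one _).1 hsup)
    obtain ⟨r, hr⟩ := hJ.1 ht
    refine ⟨t, r, ?_, hr⟩
    rw [← htu, sub_add_cancel_left]
    exact neg_mem hu
  refine le_antisymm (fun x hx ↦ ?_) Ideal.le_comap_map
  have key (y : SInt S) (hy : y ∈ extIdeal S 𝔨) : ∃ t r : 𝓞 L, t - 1 ∈ 𝔨 ∧ r ∈ 𝔨 ∧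
      algebraMap (𝓞 L) (SInt S) t * y = algebraMap (𝓞 L) (SInt S) r := by
    refine Submodule.span_induction (p := fun y _ ↦ ∃ t r : 𝓞 L, t - 1 ∈ 𝔨 ∧ r ∈ 𝔨 ∧
      algebraMap (𝓞 L) (SInt S) t * y = algebraMap (𝓞 L) (SInt S) r) ?_ ?_ ?_ ?_ hy
    · rintro _ ⟨r, hr, rfl⟩
      exact ⟨1, r, by simp, hr, by simp⟩
    · exact ⟨1, 0, by simp, zero_mem _, by simp⟩
    · rintro y y' - - ⟨t, r, ht, hr, h⟩ ⟨t', r', ht', hr', h'⟩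
      refine ⟨t * t', t' * r + t * r', ?_, add_mem (Ideal.mul_mem_left _ _ hr)
        (Ideal.mul_mem_left _ _ hr'), ?_⟩
      · rw [show t * t' - 1 = t * (t' - 1) + (t - 1) by ring]
        exact add_mem (Ideal.mul_mem_left _ _ ht') ht
      · simp only [map_mul, map_add, ← h, ← h']
        ring
    · rintro s y - ⟨t, r, ht, hr, h⟩
      obtain ⟨t', r', ht', h'⟩ := hden s
      refine ⟨t * t', r' * r, ?_, Ideal.mul_mem_left _ _ hr, ?_⟩
      · rw [show t * t' - 1 = t * (t' - 1) + (t - 1) by ring]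
        exact add_mem (Ideal.mul_mem_left _ _ ht') ht
      · simp only [map_mul, ← h, ← h', smul_eq_mul]
        ring
  obtain ⟨t, r, ht, hr, h⟩ := key _ (Ideal.mem_comap.1 hx)
  rw [← map_mul] at h
  -- Here `t * x = r`, with `r` and `t - 1` both in `𝔨`.
  rw [show x = r - (t - 1) * x by rw [← hinj h]; ring]
  exact sub_mem hr (Ideal.mul_mem_right _ _ ht)

theorem comap_int_extIdeal {𝔨 : Ideal (𝓞 L)} (h0 : 𝔨 ≠ ⊥) (hS : ∀ 𝔮 ∈ S, ¬ 𝔮.asIdeal ∣ 𝔨) :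
    (extIdeal S 𝔨).comap (algebraMap ℤ (SInt S)) = 𝔨.comap (algebraMap ℤ (𝓞 L)) := by
  rw [RingHom.ext_int (algebraMap ℤ (SInt S))
    ((algebraMap (𝓞 L) (SInt S)).comp (algebraMap ℤ (𝓞 L))), ← Ideal.comap_comap,
    comap_extIdeal h0 hS]

end Arithmetic

/-! ### From word length to the injectivity radius of a cover -/

section Cover

open Manifold
open scoped Pointwise

/-- `HasCoverGroup` concerns a single point `w₀`. Moving the base point to `y` and closing up by `τ`
both only conjugate the image loop, and `G` is normal. -/
theorem basedLoop_map_mem {V W : Type*} [TopologicalSpace V] [TopologicalSpace W]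
    [PathConnectedSpace W] {p : C(W, V)} {x₀ : V} {G : Subgroup (FundamentalGroup V x₀)}
    [G.Normal] (hG : HasCoverGroup p x₀ G) (τ : ∀ y : V, Path.Homotopic.Quotient x₀ y) {y : W}
    (d : Path.Homotopic.Quotient y y) : basedLoop τ (d.map p) ∈ G := by
  obtain ⟨w₀, h, rfl⟩ := hG
  let η : Path.Homotopic.Quotient w₀ y := .mk (PathConnectedSpace.somePath w₀ y)
  let e : FundamentalGroup W w₀ := η.trans (d.trans η.symm)
  have he : basedLoop τ (Path.Homotopic.Quotient.map e p) ∈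
      (FundamentalGroup.mapOfEq p h).range := by
    have hmem : FundamentalGroup.mapOfEq p h e ∈ (FundamentalGroup.mapOfEq p h).range := ⟨e, rfl⟩
    rw [← basedLoop_cast τ h.symm h.symm, ← FundamentalGroup.mapOfEq_apply p h, basedLoop_self]
    exact Subgroup.Normal.conj_mem' inferInstance _ hmem _
  have hconj : basedLoop τ (Path.Homotopic.Quotient.map e p) =
      (basedLoop τ (η.map p))⁻¹ * basedLoop τ (d.map p) * basedLoop τ (η.map p) := by
    rw [← basedLoop_symm, ← Path.Homotopic.Quotient.map_symm, ← basedLoop_trans,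
      ← basedLoop_trans, ← Path.Homotopic.Quotient.map_trans, ← Path.Homotopic.Quotient.map_trans]
  rw [hconj] at he
  have := Subgroup.Normal.conj_mem inferInstance _ he (basedLoop τ (η.map p))
  rwa [← mul_assoc, mul_inv_cancel_right, mul_inv_cancel_left] at this

variable {E : Type*} [NormedAddCommGroup E] [NormedSpace ℝ E]
  {H : Type*} [TopologicalSpace H] {I : ModelWithCorners ℝ E H}
  {V : Type*} [TopologicalSpace V] [ChartedSpace H V]
  [RiemannianBundle (fun x : V ↦ TangentSpace I x)]

theorem homotopyClassLength_lt_iff {p q : V} {c : Path.Homotopic.Quotient p q} {r : ℝ≥0∞} :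
    homotopyClassLength I c < r ↔ ∃ γ : Path p q, .mk γ = c ∧ ContMDiff (𝓡∂ 1) I 1 γ ∧
      ∫⁻ t, ‖mfderiv (𝓡∂ 1) I γ t 1‖ₑ < r := by
  simp only [homotopyClassLength, iInf_lt_iff, exists_prop]

/-- A Riemannian covering does not increase the length of a class of paths. -/
theorem homotopyClassLength_map_le {W : Type*} [TopologicalSpace W] [ChartedSpace H W]
    [RiemannianBundle (fun x : W ↦ TangentSpace I x)] {f : C(W, V)}
    (hf : IsRiemannianCovering I f) {p q : W} (c : Path.Homotopic.Quotient p q) :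
    homotopyClassLength I (c.map f) ≤ homotopyClassLength I c := by
  refine le_of_forall_gt fun r hr ↦ ?_
  obtain ⟨γ, rfl, hγ, hlt⟩ := homotopyClassLength_lt_iff.1 hr
  refine homotopyClassLength_lt_iff.2 ⟨γ.map f.continuous, rfl, ?_, ?_⟩
  · exact (hf.contMDiff.of_le (by simp)).comp hγ
  · exact (lintegral_enorm_mfderiv_comp hf hγ).trans_lt hlt

/-- On a closed Riemannian manifold, all classes of paths of length less than `N δ` close up to
products of `N` elements of a fixed finite subset of the fundamental group. -/
theorem exists_basedLoop_mem_pow_of_homotopyClassLength_lt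
    {F : Type*} [NormedAddCommGroup F] [NormedSpace ℝ F] {J : ModelWithCorners ℝ E F}
    {M : Type*} [TopologicalSpace M] [T2Space M] [CompactSpace M] [ConnectedSpace M]
    [ChartedSpace F M] [RiemannianBundle (fun x : M ↦ TangentSpace J x)] [IsManifold J 1 M]
    [IsContinuousRiemannianBundle E (fun x : M ↦ TangentSpace J x)]
    (x₀ : M) :
    ∃ (τ : ∀ p : M, Path.Homotopic.Quotient x₀ p) (T : Set (FundamentalGroup M x₀)),
      T.Finite ∧ ∃ δ : ℝ, 0 < δ ∧ ∀ {p q : M} (c : Path.Homotopic.Quotient p q) (N : ℕ),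
        homotopyClassLength J c < ENNReal.ofReal (N * δ) → basedLoop τ c ∈ T ^ N := by
  let : PseudoEMetricSpace M := .ofRiemannianMetric J M
  have : LocallyPathConnectedSpace M := ChartedSpace.locallyPathConnectedSpace F M
  have : PathConnectedSpace M := pathConnectedSpace_iff_connectedSpace.2 inferInstance
  obtain ⟨τ, T, hT, ε, hε, h⟩ := exists_finite_basedLoop_mem
    (ChartedSpace.exists_mem_nhds_contractibleSpace (E := F)) x₀
  obtain ⟨δ, hδ0, hδ⟩ := ENNReal.lt_iff_exists_nnreal_btwn.1 hε
  refine ⟨τ, T, hT, δ, by simpa using hδ0, fun c N hc ↦ ?_⟩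
  obtain ⟨γ, rfl, hγ, hlt⟩ := homotopyClassLength_lt_iff.1 hc
  obtain ⟨t, ht0, htN, ht⟩ := exists_subdivision hγ (by simpa using hδ0) hlt
  refine basedLoop_mem_pow τ γ t N ht0 htN fun i hi ↦ h _ fun x hx ↦ ?_
  rw [Metric.mem_eball, edist_comm]
  exact (ht i hi x hx).trans (by simpa using hδ)

/-- Two points of a ball over the same `y` differ by a loop in `W`. Pushed to the base, it lies in
`G` and is an element of `T ^ N` times the inverse of another, hence trivial by `hN`. A covering map
is injective on path classes, so the two points agree. -/
theorem ofReal_le_injRad {W : Type*} [TopologicalSpace W] [ChartedSpace H W]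
    [RiemannianBundle (fun x : W ↦ TangentSpace I x)] [PathConnectedSpace W] {f : C(W, V)}
    (hf : IsRiemannianCovering I f) {x₀ : V} {τ : ∀ p : V, Path.Homotopic.Quotient x₀ p}
    {T : Set (FundamentalGroup V x₀)} {δ : ℝ}
    (hT : ∀ {p q : V} (c : Path.Homotopic.Quotient p q) (N : ℕ),
      homotopyClassLength I c < ENNReal.ofReal (N * δ) → basedLoop τ c ∈ T ^ N)
    {G : Subgroup (FundamentalGroup V x₀)} [G.Normal] (hG : HasCoverGroup f x₀ G) {N : ℕ}
    (hN : ∀ g ∈ (T ∪ T⁻¹) ^ (2 * N), g ∈ G → g = 1) :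
    ENNReal.ofReal (N * δ) ≤ injRad I W := by
  refine le_sSup fun x z ↦ ?_
  rintro ⟨y, a⟩ ha ⟨y', b⟩ hb (rfl : y = y')
  have ha' := hT _ N ((homotopyClassLength_map_le hf _).trans_lt ha)
  have hb' := hT _ N ((homotopyClassLength_map_le hf _).trans_lt hb)
  set ca := z.2.symm.trans a with hca
  set cb := z.2.symm.trans b with hcb
  have hloop : basedLoop τ ((ca.symm.trans cb).map f) =
      basedLoop τ (cb.map f) * (basedLoop τ (ca.map f))⁻¹ := by
    rw [Path.Homotopic.Quotient.map_trans, Path.Homotopic.Quotient.map_symm, basedLoop_trans,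
      basedLoop_symm]
  have h1 : basedLoop τ ((ca.symm.trans cb).map f) = 1 := by
    refine hN _ ?_ (basedLoop_map_mem hG τ _)
    rw [hloop, two_mul, pow_add]
    refine Set.mul_mem_mul (Set.pow_subset_pow_left Set.subset_union_left hb') ?_
    refine Set.pow_subset_pow_left Set.subset_union_right ?_
    rw [inv_pow]
    exact Set.inv_mem_inv.2 ha'
  have hab : ca.map f = cb.map f := by
    apply basedLoop_injective τ
    rw [hloop, mul_inv_eq_one] at h1
    exact h1.symm
  have := hf.isCoveringMap.injective_path_homotopic_map _ _ hab
  rw [Path.Homotopic.Quotient.trans_left_injective _ this]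

end Cover

/-! ### The growth bound -/

theorem mainTheorem9
    (n : ℕ)
    (V : Type*) [TopologicalSpace V] [T2Space V] [CompactSpace V] [ConnectedSpace V]
    [ChartedSpace (EuclideanSpace ℝ (Fin n)) V] [IsManifold (𝓡 n) ∞ V]
    [RiemannianBundle (fun x : V ↦ TangentSpace (𝓡 n) x)]
    [IsContMDiffRiemannianBundle (𝓡 n) ∞ (EuclideanSpace ℝ (Fin n))
      (fun x : V ↦ TangentSpace (𝓡 n) x)]
    (hV : IsAspherical V) (x₀ : V)
    (L : Type*) [Field L] [NumberField L]
    (S : Set (IsDedekindDomain.HeightOneSpectrum (NumberField.RingOfIntegers L))) (hS : S.Finite)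
    (m : ℕ)
    (ρ : FundamentalGroup V x₀ →* Matrix.SpecialLinearGroup (Fin m) (SInt S))
    (hρ : Function.Injective ρ) :
    ∃ C D : ℝ, 0 < C ∧
      ∀ 𝔨 : Ideal (NumberField.RingOfIntegers L), 𝔨 ≠ ⊥ →
      -- `p : W → V` is the Riemannian cover `V_𝔨` of `V`
      ∀ (W : Type*) [TopologicalSpace W] [ConnectedSpace W]
        [ChartedSpace (EuclideanSpace ℝ (Fin n)) W] [IsManifold (𝓡 n) ∞ W]
        [RiemannianBundle (fun x : W ↦ TangentSpace (𝓡 n) x)]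
        [IsContMDiffRiemannianBundle (𝓡 n) ∞ (EuclideanSpace ℝ (Fin n))
          (fun x : W ↦ TangentSpace (𝓡 n) x)]
        (p : C(W, V)), IsRiemannianCovering (𝓡 n) p →
        HasCoverGroup p x₀ ((congruenceSubgroup m S 𝔨).comap ρ) →
        -- the bound for `(k) = 𝔨 O_S ∩ ℤ`
        (∀ k : ℕ, (extIdeal S 𝔨).comap (algebraMap ℤ (SInt S)) = Ideal.span {(k : ℤ)} →
          ENNReal.ofReal (C * Real.log k + D) ≤ injRad (𝓡 n) W) ∧
        -- the bound for `(k) = 𝔨 ∩ ℤ`, if no prime in `S` divides `𝔨`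
        ((∀ 𝔮 ∈ S, ¬ 𝔮.asIdeal ∣ 𝔨) →
          ∀ k : ℕ, 𝔨.comap (algebraMap ℤ (NumberField.RingOfIntegers L)) = Ideal.span {(k : ℤ)} →
            ENNReal.ofReal (C * Real.log k + D) ≤ injRad (𝓡 n) W) := by
  have : IsContinuousRiemannianBundle (EuclideanSpace ℝ (Fin n))
      (fun x : V ↦ TangentSpace (𝓡 n) x) := by
    obtain ⟨g, hg, h⟩ := IsContMDiffRiemannianBundle.exists_contMDiff (IB := 𝓡 n) (n := ∞)
      (F := EuclideanSpace ℝ (Fin n)) (E := fun x : V ↦ TangentSpace (𝓡 n) x)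
    exact ⟨g, hg.continuous, h⟩
  have : IsManifold (𝓡 n) 1 V := .of_le (n := ∞) (by simp)
  obtain ⟨τ, T, hTfin, δ, hδ, hT⟩ :=
    exists_basedLoop_mem_pow_of_homotopyClassLength_lt (J := 𝓡 n) x₀
  obtain ⟨K, hK, hlog⟩ := exists_log_le_mul_of_mem_congruenceSubgroup
    ((hTfin.union hTfin.inv).image ρ)
  -- Words of length `2 N` are excluded while `2 N K < log k`, which allows the radius `N δ` for `N`
  -- just below `ℓ = log k / (2 K)`; rounding costs at most one `δ`.
  refine ⟨δ / (2 * K), -δ, by positivity, fun 𝔨 h𝔨 W _ _ _ _ _ _ p hp hG ↦ ?_⟩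
  have : LocallyPathConnectedSpace W :=
    ChartedSpace.locallyPathConnectedSpace (EuclideanSpace ℝ (Fin n)) W
  have : PathConnectedSpace W := pathConnectedSpace_iff_connectedSpace.2 inferInstance
  have : (congruenceSubgroup m S 𝔨).Normal := MonoidHom.normal_ker _
  have main (k : ℕ)
      (hk : (extIdeal S 𝔨).comap (algebraMap ℤ (SInt S)) = Ideal.span {(k : ℤ)}) :
      ENNReal.ofReal (δ / (2 * K) * Real.log k + -δ) ≤ injRad (𝓡 n) W := by
    set ℓ := Real.log k / (2 * K) with hℓ
    have hrad : δ / (2 * K) * Real.log k + -δ = (ℓ - 1) * δ := by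
      rw [hℓ]
      ring
    rw [hrad]
    -- For `ℓ ≤ 1` the bound is nonpositive and `ENNReal.ofReal` turns it into 0.
    rcases le_or_gt ℓ 1 with h | h
    · rw [ENNReal.ofReal_of_nonpos (mul_nonpos_of_nonpos_of_nonneg (by linarith) hδ.le)]
      exact zero_le
    -- This choice gives `ℓ - 1 ≤ N < ℓ`; the strict inequality contradicts `log k ≤ 2 N K`.
    set N := ⌈ℓ - 1⌉₊ with hN
    have hNlt : N < ℓ := by
      have := Nat.ceil_lt_add_one (show 0 ≤ ℓ - 1 by linarith)
      linarith
    refine (ENNReal.ofReal_le_ofReal (mul_le_mul_of_nonneg_right (Nat.le_ceil _) hδ.le)).trans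
      (ofReal_le_injRad hp hT hG fun g hg hgG ↦ ?_)
    by_contra hg1
    open scoped Pointwise in
    have hmem : ρ g ∈ (ρ '' (T ∪ T⁻¹)) ^ (2 * N) := by
      rw [← Set.image_pow]
      exact ⟨g, hg, rfl⟩
    have hle := hlog (2 * N) (ρ g) hmem (fun h ↦ hg1 (hρ (h.trans (map_one ρ).symm))) 𝔨 hgG k hk
    rw [hℓ, lt_div_iff₀ (by positivity)] at hNlt
    push_cast at hle
    linarith
  exact ⟨main, fun hS k hk ↦ main k ((comap_int_extIdeal h𝔨 hS).trans hk)⟩
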